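/- Let $f:\mathbb R^d\to\mathbb R$ be differentiable with non-empty set of minimizers $\mathcal X^\ast=\arg\min f$, and $f^\ast=\min f$. Let $L,\mu>0$, $\rho\ge 1$, $c=\frac{1+\sqrt{1+4\rho}}{2}$, and assume $\frac{\mu}{L}\le c^{-4}$. Assume that: - ($L$-smoothness) $f(x)-f(y)-\langle\nabla f(y),x-y\rangle\le\frac L2\|x-y\|^2$ for all $x,y\in\mathbb R^d$; - $\mathcal X^\ast$ (which is closed) is convex and has $C^2$ boundary, i.e. its topological boundary is locally a $C^2$ submanifold of $\mathbb R^d$; let $\pi$ be the orthogonal projection onto $\mathcal X^\ast$; - (projected strong quasar convexity) $f^\ast\ge f(x)+\langle\nabla f(x),\pi(x)-x\rangle+\frac\mu2\|x-\pi(x)\|^2$ for all $x\in\mathbb R^d$; - (strong growth condition) there are a probability law $\mathcal P$ on a measurable space $\Xi$ and a jointly measurable map $(x,\xi)\mapsto\nabla f(x,\xi)\in\mathbb R^d$ such that, for $\xi\sim\mathcal P$ and every $x\in\mathbb R^d$, $\nabla f(x,\xi)$ is square integrable, $\mathbb E[\nabla f(x,\xi)]=\nabla f(x)$ and $\mathbb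 E[\|\nabla f(x,\xi)\|^2]\le\rho\|\nabla f(x)\|^2$. Let $T_0=0$, let the increments $T_{k+1}-T_k$ ($k\ge 0$) be i.i.d. exponential random variables with parameter $1$, and let $\xi_1,\xi_2,\dots$ be i.i.d. with law $\mathcal P$ and independent of $(T_k)_k$. Put $$\gamma=\frac1{\rho L},\qquad \gamma'=\frac1{\rho\sqrt{\mu L}},\qquad \eta=\frac{1-c\,(\mu/L)^{1/4}}{\rho}\sqrt{\frac\mu L},\qquad \eta'=\frac1\rho\sqrt{\frac\mu L}.$$ Let $\tilde x_0=\tilde z_0=x_0\in\mathbb R^d$ be deterministic and let $(\tilde x_k,\tilde y_k,\tilde z_k)$ be the iterates of the continuized Nesterov algorithm $$\begin{aligned}\tilde y_k&=\tilde x_k+\tfrac{\eta}{\eta+\eta'}\bigl(1-e^{-(\eta+\eta')(T_{k+1}-T_k)}\bigr)(\tilde z_k-\tilde x_k),\\ \tilde x_{k+1}&=\tilde y_k-\gamma\nabla f(\tilde y_k,\xi_{k+1}),\\ \tilde z_{k+1}&=\tilde z_k+\eta'\,\tfrac{1-e^{-(\eta+\eta')(T_{k+1}-T_k)}}{\eta'+\eta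 e^{-(\eta+\eta')(T_{k+1}-T_k)}}(\tilde y_k-\tilde z_k)-\gamma'\nabla f(\tilde y_k,\xi_{k+1}).\end{aligned}$$ Then, for every $k\in\mathbb N$, the random variable $e^{\eta T_k}(f(\tilde x_k)-f^\ast)$ is integrable and $$\mathbb E\bigl[e^{\eta T_k}(f(\tilde x_k)-f^\ast)\bigr]\le f(x_0)-f^\ast+\mu\bigl(1-c\,(\mu/L)^{1/4}\bigr)\|x_0-\pi(x_0)\|^2 .$$ -/

import Mathlib

open MeasureTheory ProbabilityTheory
open scoped Gradient RealInnerProductSpace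

noncomputable section

/-- The set of global minimizers of `f`. -/
def argminSet {d : ℕ} (f : EuclideanSpace ℝ (Fin d) → ℝ) : Set (EuclideanSpace ℝ (Fin d)) :=
  {x | ∀ y, f x ≤ f y}

/-- The minimal value of `f` (attained whenever `argminSet f` is nonempty). -/
def minVal {d : ℕ} (f : EuclideanSpace ℝ (Fin d) → ℝ) : ℝ := ⨅ x, f x

theorem minVal_eq {d : ℕ} {f : EuclideanSpace ℝ (Fin d) → ℝ} {x : EuclideanSpace ℝ (Fin d)}
    (hx : x ∈ argminSet f) : minVal f = f x :=
  le_antisymm (ciInf_le ⟨f x, by rintro _ ⟨y, rfl⟩; exact hx y⟩ x) (le_ciInf hx)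

open Classical in
/-- The orthogonal projection onto `S`: a point of `S` nearest to `x`, with the value `x` if there
is none. It is the unique nearest point when `S` is nonempty, closed and convex. -/
def orthProj {d : ℕ} (S : Set (EuclideanSpace ℝ (Fin d))) (x : EuclideanSpace ℝ (Fin d)) :
    EuclideanSpace ℝ (Fin d) :=
  if h : ∃ p ∈ S, ∀ y ∈ S, ‖x - p‖ ≤ ‖x - y‖ then h.choose else x

theorem orthProj_spec {d : ℕ} {S : Set (EuclideanSpace ℝ (Fin d))} (hS : S.Nonempty)
    (hc : IsClosed S) (x : EuclideanSpace ℝ (Fin d)) :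
    orthProj S x ∈ S ∧ ∀ y ∈ S, ‖x - orthProj S x‖ ≤ ‖x - y‖ := by
  have h : ∃ p ∈ S, ∀ y ∈ S, ‖x - p‖ ≤ ‖x - y‖ := by
    obtain ⟨p, hp, hpd⟩ := hc.exists_infDist_eq_dist hS x
    refine ⟨p, hp, fun y hy => ?_⟩
    rw [← dist_eq_norm, ← dist_eq_norm, ← hpd]
    exact Metric.infDist_le_dist_of_mem hy
  unfold orthProj
  rw [dif_pos h]
  exact h.choose_spec

/-- `L`-smoothness, as a one-sided quadratic upper bound. -/
def IsLSmooth {d : ℕ} (L : ℝ) (f : EuclideanSpace ℝ (Fin d) → ℝ) : Prop :=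
  ∀ x y, f x - f y - ⟪∇ f y, x - y⟫ ≤ L / 2 * ‖x - y‖ ^ 2

/-- Strong quasar convexity with respect to the projection onto the set of minimizers. -/
def IsProjSQC {d : ℕ} (μ : ℝ) (f : EuclideanSpace ℝ (Fin d) → ℝ) : Prop :=
  ∀ x, f x + ⟪∇ f x, orthProj (argminSet f) x - x⟫
      + μ / 2 * ‖x - orthProj (argminSet f) x‖ ^ 2 ≤ minVal f

/-- `g x ξ` with `ξ ∼ P` is an unbiased estimator of `∇ f x` that satisfies the strong growth
condition with constant `ρ`. -/
structure IsSGC {d : ℕ} {Ξ : Type*} [MeasurableSpace Ξ] (ρ : ℝ)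
    (f : EuclideanSpace ℝ (Fin d) → ℝ)
    (g : EuclideanSpace ℝ (Fin d) → Ξ → EuclideanSpace ℝ (Fin d)) (P : Measure Ξ) : Prop where
  measurable : Measurable (Function.uncurry g)
  integrable : ∀ x, Integrable (g x) P
  unbiased : ∀ x, ∫ ξ, g x ξ ∂P = ∇ f x
  integrable_sq : ∀ x, Integrable (fun ξ => ‖g x ξ‖ ^ 2) P
  growth : ∀ x, ∫ ξ, ‖g x ξ‖ ^ 2 ∂P ≤ ρ * ‖∇ f x‖ ^ 2

/-- The topological boundary of `S` is locally a `C²` submanifold: near each of its points a `C²`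
diffeomorphism between open sets straightens it into a linear subspace. -/
def HasC2Boundary {d : ℕ} (S : Set (EuclideanSpace ℝ (Fin d))) : Prop :=
  ∀ p ∈ frontier S,
    ∃ (e : OpenPartialHomeomorph (EuclideanSpace ℝ (Fin d)) (EuclideanSpace ℝ (Fin d)))
      (V : Submodule ℝ (EuclideanSpace ℝ (Fin d))),
      p ∈ e.source ∧ ContDiffOn ℝ 2 e e.source ∧ ContDiffOn ℝ 2 e.symm e.target ∧
      e '' (e.source ∩ frontier S) = e.target ∩ V

/-- The times `T 0 = 0, T 1, T 2, …` have i.i.d. increments with law `Exp(1)`. -/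
structure IsExpArrivals {Ω : Type*} [MeasurableSpace Ω] (Pr : Measure Ω) (T : ℕ → Ω → ℝ) :
    Prop where
  measurable : ∀ k, Measurable (T k)
  zero : ∀ ω, T 0 ω = 0
  law : ∀ k, Pr.map (fun ω => T (k + 1) ω - T k ω) = expMeasure 1
  indep : iIndepFun (fun k ω => T (k + 1) ω - T k ω) Pr

/-- The samples `ξ 1, ξ 2, …` are i.i.d. with law `P`. -/
structure IsIIDSamples {Ω Ξ : Type*} [MeasurableSpace Ω] [MeasurableSpace Ξ] (Pr : Measure Ω)
    (P : Measure Ξ) (ξ : ℕ → Ω → Ξ) : Prop where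
  measurable : ∀ k, Measurable (ξ (k + 1))
  law : ∀ k, Pr.map (ξ (k + 1)) = P
  indep : iIndepFun (fun k => ξ (k + 1)) Pr

/-- `(x, y, z)` are the iterates of the continuized Nesterov algorithm started at `x₀` with
constant parameters `η, η', γ, γ'`, stochastic gradients `g`, times `T` and samples `ξ`. -/
structure IsCNA {d : ℕ} {Ω Ξ : Type*}
    (g : EuclideanSpace ℝ (Fin d) → Ξ → EuclideanSpace ℝ (Fin d)) (η η' γ γ' : ℝ)
    (T : ℕ → Ω → ℝ) (ξ : ℕ → Ω → Ξ) (x₀ : EuclideanSpace ℝ (Fin d))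
    (x y z : ℕ → Ω → EuclideanSpace ℝ (Fin d)) : Prop where
  x_zero : ∀ ω, x 0 ω = x₀
  z_zero : ∀ ω, z 0 ω = x₀
  y_eq : ∀ k ω, y k ω =
    (η / (η + η') * (1 - Real.exp (-(η + η') * (T (k + 1) ω - T k ω)))) • (z k ω - x k ω) + x k ω
  x_succ : ∀ k ω, x (k + 1) ω = y k ω - γ • g (y k ω) (ξ (k + 1) ω)
  z_succ : ∀ k ω, z (k + 1) ω = z k ω
    + (η' * ((1 - Real.exp (-(η + η') * (T (k + 1) ω - T k ω)))
        / (η' + η * Real.exp (-(η + η') * (T (k + 1) ω - T k ω))))) • (y k ω - z k ω)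
    - γ' • g (y k ω) (ξ (k + 1) ω)

/-- The constant `(1 + √(1 + 4ρ)) / 2`. -/
def growthConst (ρ : ℝ) : ℝ := (1 + √(1 + 4 * ρ)) / 2

end

/-! Let `p` be the projection onto the minimizers, s = (μ/L)^(1/4), B = μ(1 - cs). The potential
Φ(x, z) = f(x) - f* + (B/2)‖z - p(x)‖², weighted by exp(ηT_k), has nonincreasing expectation along
the iterates. Between jumps (x, z) follows x' = η(z - x), z' = η'(x - z); at a jump both coordinates
take a stochastic gradient step. The difficulty is that the anchor p(x) moves in both phases.

At a jump (`norm_step_sub_sq_le`, `lintegral_jump_le`), firm nonexpansiveness of `p` controls the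
displacement of the anchor, leaving an error η'‖z - x‖² + (γ²/η')‖g‖². Quasar convexity absorbs the
first term, because Bη' = ημ; the choice of c makes the total coefficient of ‖∇f‖² nonpositive
(`parameter_relations`). Hence the expected potential after a jump is at most Q = `driftBound`.

Along the flow (`lintegral_flow_le`), `p` need not be differentiable. The squared distance ‖x -
p(x)‖² is, however, and in the remaining cross term the anchor can be frozen at its initial value: x
moves along a ray in direction v = z - x, and monotonicity of `p` gives the error a sign. This
yields a majorant G of Φ, equal to it at time 0, with exp((η - 1)t) Q ≤ -(exp((η - 1)t) G)'.
Integrating against the density exp(-t) of the waiting time bounds the expectation after one step by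
Φ. Independence of the next waiting time and sample from the past turns this into an induction. -/

/-! ### Projections characterized by the obtuse-angle inequality -/

section NearestPoint

variable {E : Type*} [NormedAddCommGroup E] [InnerProductSpace ℝ E] {p : E → E}

/-- Sum of the obtuse-angle inequalities at the two points. -/
theorem firmly_nonexpansive (hp : ∀ x y, ⟪x - p x, p y - p x⟫ ≤ 0) (x y : E) :
    ‖p x - p y‖ ^ 2 ≤ ⟪x - y, p x - p y⟫ := by
  have h1 := hp x y
  have h2 := hp y x
  have h3 : ⟪x - y, p x - p y⟫ - ‖p x - p y‖ ^ 2
      = -⟪x - p x, p y - p x⟫ - ⟪y - p y, p x - p y⟫ := by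
    rw [← real_inner_self_eq_norm_sq]
    simp only [inner_sub_left, inner_sub_right]
    ring
  linarith

theorem nonexpansive (hp : ∀ x y, ⟪x - p x, p y - p x⟫ ≤ 0) (x y : E) :
    ‖p x - p y‖ ≤ ‖x - y‖ := by
  have h1 := firmly_nonexpansive hp x y
  have h2 := real_inner_le_norm (x - y) (p x - p y)
  by_contra! h
  nlinarith [norm_nonneg (x - y)]

theorem continuous_of_variational (hp : ∀ x y, ⟪x - p x, p y - p x⟫ ≤ 0) : Continuous p :=
  (LipschitzWith.of_dist_le_mul (K := 1) fun x y => by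
    simpa [dist_eq_norm] using nonexpansive hp x y).continuous

/-- The point `p x` competes with `p y` as an approximation of `y`. With the matching lower bound
below, this pins the squared distance to its linearization up to ‖y - x‖². -/
theorem norm_sub_sq_upper (hp : ∀ x y, ⟪x - p x, p y - p x⟫ ≤ 0) (x y : E) :
    ‖y - p y‖ ^ 2 ≤ ‖x - p x‖ ^ 2 + 2 * ⟪x - p x, y - x⟫ + ‖y - x‖ ^ 2 := by
  have h1 := hp y x
  have h2 : ‖x - p x‖ ^ 2 + 2 * ⟪x - p x, y - x⟫ + ‖y - x‖ ^ 2 - ‖y - p y‖ ^ 2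
      = ‖p x - p y‖ ^ 2 - 2 * ⟪y - p y, p x - p y⟫ := by
    simp only [← real_inner_self_eq_norm_sq, inner_sub_left, inner_sub_right]
    simp only [real_inner_comm]
    ring
  nlinarith [sq_nonneg ‖p x - p y‖]

theorem norm_sub_sq_lower (hp : ∀ x y, ⟪x - p x, p y - p x⟫ ≤ 0) (x y : E) :
    ‖x - p x‖ ^ 2 + 2 * ⟪x - p x, y - x⟫ ≤ ‖y - p y‖ ^ 2 := by
  have h1 := hp x y
  have h2 : ‖y - p y‖ ^ 2 - (‖x - p x‖ ^ 2 + 2 * ⟪x - p x, y - x⟫)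
      = ‖(y - p y) - (x - p x)‖ ^ 2 - 2 * ⟪x - p x, p y - p x⟫ := by
    simp only [← real_inner_self_eq_norm_sq, inner_sub_left, inner_sub_right]
    simp only [real_inner_comm]
    ring
  nlinarith [sq_nonneg ‖(y - p y) - (x - p x)‖]

theorem hasGradientAt_norm_sub_sq [CompleteSpace E] (hp : ∀ x y, ⟪x - p x, p y - p x⟫ ≤ 0)
    (x : E) : HasGradientAt (fun x => ‖x - p x‖ ^ 2) ((2 : ℝ) • (x - p x)) x := by
  rw [hasGradientAt_iff_isLittleO]
  refine Asymptotics.IsBigO.trans_isLittleO (g := fun y => ‖y - x‖ ^ 2) ?_ ?_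
  · refine Asymptotics.IsBigO.of_bound 1 (Filter.Eventually.of_forall fun y => ?_)
    have h1 := norm_sub_sq_upper hp x y
    have h2 := norm_sub_sq_lower hp x y
    rw [Real.norm_eq_abs, Real.norm_eq_abs, abs_of_nonneg (sq_nonneg ‖y - x‖), abs_le,
      real_inner_smul_left]
    constructor <;> nlinarith [sq_nonneg ‖y - x‖]
  · have := Asymptotics.isLittleO_pow_sub_sub (E' := E) x (m := 2) (by norm_num)
    simpa using this

/-- Effect of a pair of gradient steps on the squared distance to the projection of the first
variable. -/
theorem norm_step_sub_sq_le (hp : ∀ x y, ⟪x - p x, p y - p x⟫ ≤ 0) {γ γ' e : ℝ} (hγ : 0 < γ)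
    (hγγ' : γ ≤ γ') (he : 0 < e) (x z g : E) :
    ‖z - γ' • g - p (x - γ • g)‖ ^ 2 ≤ ‖z - p x‖ ^ 2 - 2 * γ' * ⟪z - p x, g⟫
      + (γ' ^ 2 + γ ^ 2 / e) * ‖g‖ ^ 2 + e * ‖z - x‖ ^ 2 := by
  set q := p (x - γ • g) with hq
  have h1 : ⟪x - γ • g - q, p x - q⟫ ≤ 0 := hp (x - γ • g) x
  have h2 : ‖p x - q‖ ^ 2 ≤ γ * ⟪g, p x - q⟫ := by
    simpa [real_inner_smul_left] using firmly_nonexpansive hp x (x - γ • g)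
  have h3 : ‖p x - q‖ ≤ γ * ‖g‖ := by
    simpa [norm_smul, abs_of_pos hγ] using nonexpansive hp x (x - γ • g)
  have h4 := real_inner_le_norm (z - x) (p x - q)
  have h5 : 0 ≤ ⟪g, p x - q⟫ := nonneg_of_mul_nonneg_right ((sq_nonneg _).trans h2) hγ
  -- In this expansion the terms in ‖p x - q‖², in the obtuse-angle product `h1` and in γ' - γ are
  -- nonpositive. Only ⟪z - x, p x - q⟫ needs an estimate: Young's inequality with weight `e`, after
  -- ‖p x - q‖ ≤ γ‖g‖.
  have h6 : ‖z - γ' • g - q‖ ^ 2 = ‖z - p x‖ ^ 2 - 2 * γ' * ⟪z - p x, g⟫ + γ' ^ 2 * ‖g‖ ^ 2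
      - ‖p x - q‖ ^ 2 + 2 * ⟪x - γ • g - q, p x - q⟫ + 2 * ⟪z - x, p x - q⟫
      - 2 * (γ' - γ) * ⟪g, p x - q⟫ := by
    simp only [← real_inner_self_eq_norm_sq, inner_sub_left, inner_sub_right,
      real_inner_smul_left, real_inner_smul_right]
    simp only [real_inner_comm]
    ring
  have h7 : 2 * (‖z - x‖ * ‖p x - q‖) ≤ e * ‖z - x‖ ^ 2 + γ ^ 2 / e * ‖g‖ ^ 2 := by
    have h8 : 2 * (‖z - x‖ * ‖p x - q‖) ≤ 2 * (‖z - x‖ * (γ * ‖g‖)) := by gcongr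
    have h9 : e * ‖z - x‖ ^ 2 + γ ^ 2 / e * ‖g‖ ^ 2 - 2 * (‖z - x‖ * (γ * ‖g‖))
        = (e * ‖z - x‖ - γ * ‖g‖) ^ 2 / e := by
      field_simp
      ring
    have h10 : 0 ≤ (e * ‖z - x‖ - γ * ‖g‖) ^ 2 / e := by positivity
    linarith
  have h11 : 0 ≤ (γ' - γ) * ⟪g, p x - q⟫ := mul_nonneg (by linarith) h5
  nlinarith [sq_nonneg ‖p x - q‖]

end NearestPoint

/-! ### Algebra of the step sizes -/

section Parameters

theorem growthConst_sq {ρ : ℝ} (hρ : 0 ≤ ρ) : growthConst ρ ^ 2 = growthConst ρ + ρ := by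
  have := Real.sq_sqrt (show 0 ≤ 1 + 4 * ρ by linarith)
  unfold growthConst
  linear_combination this / 4

theorem one_le_growthConst {ρ : ℝ} (hρ : 0 ≤ ρ) : 1 ≤ growthConst ρ := by
  have : 1 ≤ √(1 + 4 * ρ) := Real.one_le_sqrt.2 (by linarith)
  unfold growthConst
  linarith

theorem parameter_relations {L μ ρ : ℝ} (hL : 0 < L) (hμ : 0 < μ) (hρ : 1 ≤ ρ)
    (hκ : μ / L ≤ growthConst ρ ^ (-4 : ℤ)) {η η' γ γ' B : ℝ} (hγ : γ = 1 / (ρ * L))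
    (hγ' : γ' = 1 / (ρ * √(μ * L)))
    (hη : η = (1 - growthConst ρ * (μ / L) ^ (1 / 4 : ℝ)) / ρ * √(μ / L))
    (hη' : η' = 1 / ρ * √(μ / L)) (hB : B = μ * (1 - growthConst ρ * (μ / L) ^ (1 / 4 : ℝ))) :
    0 ≤ B ∧ 0 ≤ η ∧ η ≤ η' ∧ 0 < η' ∧ 0 < γ ∧ γ ≤ γ' ∧ B * γ' = η ∧ B * η' = η * μ ∧
      -γ + L * γ ^ 2 * ρ / 2 + B / 2 * (γ' ^ 2 + γ ^ 2 / η') * ρ ≤ 0 := by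
  set c := growthConst ρ with hc
  have hc1 : 1 ≤ c := one_le_growthConst (by linarith)
  have hc2 : c ^ 2 = c + ρ := growthConst_sq (by linarith)
  have hμL : 0 < μ / L := div_pos hμ hL
  set s := (μ / L) ^ (1 / 4 : ℝ) with hs
  have hs0 : 0 < s := Real.rpow_pos_of_pos hμL _
  have hs4 : s ^ 4 = μ / L := by
    rw [hs, ← Real.rpow_natCast, ← Real.rpow_mul hμL.le]
    norm_num
  -- The assumption on μ/L amounts to cs ≤ 1, which makes B and η nonnegative.
  have hcs : c * s ≤ 1 := by
    have h1 : (c * s) ^ 4 ≤ 1 := by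
      rw [mul_pow, hs4]
      calc c ^ 4 * (μ / L) ≤ c ^ 4 * c ^ (-4 : ℤ) := by gcongr
        _ = 1 := by
          rw [zpow_neg]
          exact mul_inv_cancel₀ (by positivity)
    exact (pow_le_one_iff_of_nonneg (by positivity) (by norm_num)).1 h1
  have hs1 : s ≤ 1 := le_trans (by nlinarith) hcs
  have hμs : μ = L * s ^ 4 := by rw [hs4]; field_simp
  have hr : √(μ / L) = s ^ 2 := by
    rw [← hs4, show s ^ 4 = (s ^ 2) ^ 2 by ring, Real.sqrt_sq (by positivity)]
  have hr' : √(μ * L) = L * s ^ 2 := by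
    rw [hμs, show L * s ^ 4 * L = (L * s ^ 2) ^ 2 by ring, Real.sqrt_sq (by positivity)]
  have hu : 0 ≤ 1 - c * s := by linarith
  have hρ0 : 0 < ρ := by linarith
  rw [hr] at hη hη'
  rw [hr'] at hγ'
  have hs2 : s ^ 2 ≤ 1 := pow_le_one₀ hs0.le hs1
  refine ⟨?_, ?_, ?_, ?_, ?_, ?_, ?_, ?_, ?_⟩
  · rw [hB]; positivity
  · rw [hη]; positivity
  · rw [hη, hη']
    gcongr
    nlinarith
  · rw [hη']; positivity
  · rw [hγ]; positivity
  · rw [hγ, hγ']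
    gcongr
    nlinarith
  · rw [hB, hγ', hη, hμs]; field_simp
  · rw [hB, hη', hη]; field_simp
  · have h1 : -γ + L * γ ^ 2 * ρ / 2 + B / 2 * (γ' ^ 2 + γ ^ 2 / η') * ρ
        = ((1 - c * s) * (1 + ρ * s ^ 2) - 1) / (2 * (ρ * L)) := by
      rw [hγ, hγ', hη', hB, hμs]
      field_simp
      ring
    rw [h1]
    refine div_nonpos_of_nonpos_of_nonneg ?_ (by positivity)
    -- This factorization is where c² = c + ρ enters.
    have h2 : (1 - c * s) * (1 + ρ * s ^ 2) - 1
        = -(c * s) * (1 - (c * s - s) * (1 - c * s)) := by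
      rw [show ρ = c ^ 2 - c by linarith]
      ring
    have h3 : (c * s - s) * (1 - c * s) ≤ 1 :=
      mul_le_one₀ (by linarith) hu (by nlinarith)
    rw [h2]
    have : 0 < c * s := by positivity
    nlinarith

end Parameters

/-! ### The flow between jumps, averaged over an exponential waiting time -/

section Flow

theorem setLIntegral_Ioc_le_of_hasDerivAt {F F' : ℝ → ℝ} {q : ℝ → ENNReal} {M : ℝ} (hM : 0 ≤ M)
    (hF : ∀ t, HasDerivAt F (F' t) t) (hF0 : 0 ≤ F M) (hF' : ∀ t, 0 ≤ t → F' t ≤ 0)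
    (hq : ∀ t, 0 ≤ t → q t ≤ ENNReal.ofReal (-F' t)) :
    ∫⁻ t in Set.Ioc 0 M, q t ≤ ENNReal.ofReal (F 0) := by
  have hcont : ContinuousOn (fun t => -F t) (Set.Icc 0 M) := fun t _ =>
    (hF t).continuousAt.continuousWithinAt.neg
  have hint : IntegrableOn (fun t => -F' t) (Set.Ioc 0 M) :=
    intervalIntegral.integrableOn_deriv_of_nonneg hcont (fun t _ => (hF t).neg)
      fun t ht => neg_nonneg.2 (hF' t ht.1.le)
  have hFTC : ∫ t in Set.Ioc 0 M, -F' t = -F M - -F 0 := by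
    rw [← intervalIntegral.integral_of_le hM]
    exact intervalIntegral.integral_eq_sub_of_hasDerivAt (fun t _ => (hF t).neg)
      ((intervalIntegrable_iff_integrableOn_Ioc_of_le hM).2 hint)
  calc ∫⁻ t in Set.Ioc 0 M, q t ≤ ∫⁻ t in Set.Ioc 0 M, ENNReal.ofReal (-F' t) :=
        setLIntegral_mono' measurableSet_Ioc fun t ht => hq t ht.1.le
    _ = ENNReal.ofReal (∫ t in Set.Ioc 0 M, -F' t) :=
        (ofReal_integral_eq_lintegral_ofReal hint ((ae_restrict_iff' measurableSet_Ioc).2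
          (Filter.Eventually.of_forall fun t ht => neg_nonneg.2 (hF' t ht.1.le)))).symm
    _ ≤ ENNReal.ofReal (F 0) := by
        rw [hFTC]
        exact ENNReal.ofReal_le_ofReal (by linarith)

theorem lintegral_expMeasure_one (h : ℝ → ENNReal) (hh : Measurable h) :
    ∫⁻ t, h t ∂(expMeasure 1) = ∫⁻ t in Set.Ioi 0, ENNReal.ofReal (Real.exp (-t)) * h t := by
  have h1 : expMeasure 1 = volume.withDensity (exponentialPDF 1) := rfl
  have hm : Measurable (exponentialPDF 1) := (measurable_exponentialPDFReal 1).ennreal_ofReal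
  rw [h1, lintegral_withDensity_eq_lintegral_mul _ hm hh, ← lintegral_indicator measurableSet_Ioi]
  refine lintegral_congr_ae ?_
  -- The density equals 1 at 0, a point missing from the open half-line.
  filter_upwards [compl_mem_ae_iff.2 (measure_singleton (0 : ℝ))] with t ht
  rw [Pi.mul_apply, exponentialPDF_eq]
  rcases lt_or_gt_of_ne (show t ≠ 0 from ht) with h0 | h0
  · simp [h0.not_ge, h0.le]
  · simp [h0, h0.le]

/-- The fundamental theorem of calculus on (0, n], then n → ∞ by monotone convergence. Nonnegativity
of `F` replaces any decay at infinity. -/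
theorem lintegral_expMeasure_one_le {F F' : ℝ → ℝ} {h : ℝ → ENNReal} (hh : Measurable h)
    (hF : ∀ t, HasDerivAt F (F' t) t) (hF0 : ∀ t, 0 ≤ t → 0 ≤ F t) (hF' : ∀ t, 0 ≤ t → F' t ≤ 0)
    (hq : ∀ t, 0 ≤ t → ENNReal.ofReal (Real.exp (-t)) * h t ≤ ENNReal.ofReal (-F' t)) :
    ∫⁻ t, h t ∂(expMeasure 1) ≤ ENNReal.ofReal (F 0) := by
  have hU : Set.Ioi (0 : ℝ) = ⋃ n : ℕ, Set.Ioc 0 (n : ℝ) := by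
    ext t
    simp only [Set.mem_Ioi, Set.mem_iUnion, Set.mem_Ioc, exists_and_left, iff_self_and]
    exact fun _ => exists_nat_ge t
  rw [lintegral_expMeasure_one h hh, hU, setLIntegral_iUnion_of_directed]
  · exact iSup_le fun n => setLIntegral_Ioc_le_of_hasDerivAt n.cast_nonneg hF
      (hF0 n n.cast_nonneg) hF' hq
  · exact directed_of_isDirected_le fun a b hab => Set.Ioc_subset_Ioc_right (by exact_mod_cast hab)

variable {E : Type*} [NormedAddCommGroup E] [InnerProductSpace ℝ E] {p : E → E}

/-- Monotonicity of the projection along a ray; it signs the error made by freezing the anchor. -/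
theorem inner_proj_sub_nonneg (hp : ∀ x y, ⟪x - p x, p y - p x⟫ ≤ 0) (x v : E) {a : ℝ}
    (ha : 0 ≤ a) : 0 ≤ ⟪v, p (x + a • v) - p x⟫ := by
  rcases ha.eq_or_lt with rfl | ha
  · simp
  · have h := firmly_nonexpansive hp (x + a • v) x
    rw [add_sub_cancel_left, real_inner_smul_left] at h
    exact nonneg_of_mul_nonneg_right ((sq_nonneg _).trans h) ha

/-- First component of the deterministic flow between two jumps. -/
noncomputable def flowFst {E : Type*} [AddCommGroup E] [Module ℝ E] (η η' : ℝ) (x z : E) (t : ℝ) :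
    E :=
  x + (η / (η + η') * (1 - Real.exp (-(η + η') * t))) • (z - x)

/-- Second component of the deterministic flow between two jumps. -/
noncomputable def flowSnd {E : Type*} [AddCommGroup E] [Module ℝ E] (η η' : ℝ) (x z : E) (t : ℝ) :
    E :=
  flowFst η η' x z t + Real.exp (-(η + η') * t) • (z - x)

/-- Along the deterministic flow between two jumps, an upper bound `Q` of the expected Lyapunov
function after a jump integrates to at most the initial value of the Lyapunov function. -/
theorem lintegral_flow_le [CompleteSpace E] (hp : ∀ x y, ⟪x - p x, p y - p x⟫ ≤ 0) {f : E → ℝ}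
    {f' : E → E} (hf : ∀ x, HasGradientAt f (f' x) x) {m : ℝ} (hm : ∀ x, m ≤ f x)
    {B η η' : ℝ} (hB : 0 ≤ B) (hη : 0 ≤ η) (hη' : 0 < η') {Q : E → E → ℝ}
    (hQ : ∀ x z, Q x z = (1 - η) * (f x - m + B / 2 * ‖z - p x‖ ^ 2) - η * ⟪f' x, z - x⟫
      - B * η' * ⟪z - p x, x - z⟫) (hQ0 : ∀ x z, 0 ≤ Q x z) (x z : E) {h : ℝ → ENNReal}
    (hh : Measurable h)
    (hhQ : ∀ t, h t ≤ ENNReal.ofReal (Real.exp (η * t)) * ENNReal.ofReal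
      (Q (flowFst η η' x z t) (flowSnd η η' x z t))) :
    ∫⁻ t, h t ∂(expMeasure 1) ≤ ENNReal.ofReal (f x - m + B / 2 * ‖z - p x‖ ^ 2) := by
  simp only [flowSnd, flowFst] at hhQ
  set l := η + η' with hl
  have hl0 : 0 < l := by positivity
  set v := z - x with hv
  set a : ℝ → ℝ := fun t => η / l * (1 - Real.exp (-l * t)) with ha
  set X : ℝ → E := fun t => x + a t • v with hX
  set ε : ℝ → ℝ := fun t => Real.exp (-l * t) with hε
  have hε' (t : ℝ) : HasDerivAt ε (-l * ε t) t := by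
    have := ((hasDerivAt_id t).const_mul (-l)).exp
    simpa [hε, mul_comm] using this
  have ha' (t : ℝ) : HasDerivAt a (η * ε t) t := by
    have := ((hε' t).const_sub 1).const_mul (η / l)
    refine this.congr_deriv ?_
    field_simp
  have hX' (t : ℝ) : HasDerivAt X ((η * ε t) • v) t := ((ha' t).smul_const v).const_add x
  have ha0 (t : ℝ) (ht : 0 ≤ t) : 0 ≤ a t := by
    have : Real.exp (-l * t) ≤ 1 := Real.exp_le_one_iff.2 (by nlinarith)
    exact mul_nonneg (by positivity) (by linarith)
  have hP (t : ℝ) (ht : 0 ≤ t) : 0 ≤ ⟪v, p (X t) - p x⟫ := inner_proj_sub_nonneg hp x v (ha0 t ht)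
  -- The expanded potential along the flow, with `p x` instead of `p (X t)` in the cross term. Every
  -- summand is now differentiable.
  set G : ℝ → ℝ := fun t => f (X t) - m + B / 2 * (ε t ^ 2 * ‖v‖ ^ 2
    + 2 * (ε t * ⟪v, X t - p x⟫) + ‖X t - p (X t)‖ ^ 2) with hG
  set G' : ℝ → ℝ := fun t => ⟪f' (X t), v⟫ * (η * ε t) + B / 2 * (2 * ε t * (-l * ε t) * ‖v‖ ^ 2
    + 2 * (-l * ε t * ⟪v, X t - p x⟫ + ε t * (η * ε t * ‖v‖ ^ 2))
    + 2 * ⟪X t - p (X t), v⟫ * (η * ε t)) with hG'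
  have hGd (t : ℝ) : HasDerivAt G (G' t) t := by
    have h1 : HasDerivAt (fun t => f (X t)) (⟪f' (X t), v⟫ * (η * ε t)) t := by
      have := (hf (X t)).hasFDerivAt.comp_hasDerivAt t (hX' t)
      refine this.congr_deriv ?_
      simp [mul_comm]
    have h2 : HasDerivAt (fun t => ‖X t - p (X t)‖ ^ 2)
        (2 * ⟪X t - p (X t), v⟫ * (η * ε t)) t := by
      have := (hasGradientAt_norm_sub_sq hp (X t)).hasFDerivAt.comp_hasDerivAt t (hX' t)
      refine this.congr_deriv ?_
      simp only [InnerProductSpace.toDual_apply_apply, real_inner_smul_right, real_inner_smul_left]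
      ring
    have h3 : HasDerivAt (fun t => ⟪v, X t - p x⟫) (η * ε t * ‖v‖ ^ 2) t := by
      have := (innerSL ℝ v).hasFDerivAt.comp_hasDerivAt t ((hX' t).sub_const (p x))
      refine this.congr_deriv ?_
      simp only [innerSL_apply_apply, real_inner_smul_right, real_inner_self_eq_norm_sq]
    have h4 : HasDerivAt (fun t => ε t ^ 2) (2 * ε t * (-l * ε t)) t := by
      simpa using (hε' t).fun_pow 2
    exact (h1.sub_const m).add ((((h4.mul_const _).add
      (((hε' t).mul h3).const_mul 2)).add h2).const_mul (B / 2))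
  have hexp (t : ℝ) : HasDerivAt (fun t => Real.exp ((η - 1) * t))
      ((η - 1) * Real.exp ((η - 1) * t)) t := by
    have := ((hasDerivAt_id t).const_mul (η - 1)).exp
    simpa [mul_comm] using this
  have hexp0 (t : ℝ) : 0 < Real.exp ((η - 1) * t) := Real.exp_pos _
  have hε0 (t : ℝ) : 0 < ε t := Real.exp_pos _
  have hFd (t : ℝ) := (hexp t).mul (hGd t)
  have hG0 (t : ℝ) (ht : 0 ≤ t) : 0 ≤ G t := by
    -- Freezing the anchor adds exactly 2ε⟪v, p (X t) - p x⟫ ≥ 0 to the true square.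
    have h1 : ε t ^ 2 * ‖v‖ ^ 2 + 2 * (ε t * ⟪v, X t - p x⟫) + ‖X t - p (X t)‖ ^ 2
        = ‖ε t • v + (X t - p (X t))‖ ^ 2 + 2 * (ε t * ⟪v, p (X t) - p x⟫) := by
      rw [norm_add_sq_real, real_inner_smul_left, norm_smul, Real.norm_eq_abs, mul_pow, sq_abs]
      simp only [inner_sub_right]
      ring
    have h2 := mul_nonneg (hε0 t).le (hP t ht)
    have h3 := hm (X t)
    simp only [hG]
    rw [h1]
    have : 0 ≤ B / 2 * (‖ε t • v + (X t - p (X t))‖ ^ 2 + 2 * (ε t * ⟪v, p (X t) - p x⟫)) := by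
      positivity
    linarith
  have key (t : ℝ) (ht : 0 ≤ t) :
      Real.exp ((η - 1) * t) * Q (X t) (X t + ε t • v)
        ≤ -((η - 1) * Real.exp ((η - 1) * t) * G t + Real.exp ((η - 1) * t) * G' t) := by
    -- The frozen anchor enters both G and G'; its net effect has coefficient B ε (1 + η') ≥ 0, so
    -- it can be dropped.
    have h1 : Q (X t) (X t + ε t • v)
        = -((η - 1) * G t + G' t) - B * ε t * (1 - η + l) * ⟪v, p (X t) - p x⟫ := by
      rw [hQ]
      have e1 : X t + ε t • v - p (X t) = ε t • v + (X t - p (X t)) := by abel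
      have e2 : X t - (X t + ε t • v) = -(ε t • v) := by abel
      rw [e1, e2, add_sub_cancel_left, norm_add_sq_real, inner_neg_right, inner_add_left]
      simp only [hG, hG', real_inner_smul_left, real_inner_smul_right, real_inner_self_eq_norm_sq,
        real_inner_comm v (X t - p (X t)), norm_smul, Real.norm_eq_abs, mul_pow, sq_abs]
      simp only [inner_sub_right, hl]
      ring
    have h2 : 0 ≤ B * ε t * (1 - η + l) * ⟪v, p (X t) - p x⟫ :=
      mul_nonneg (mul_nonneg (mul_nonneg hB (hε0 t).le) (by linarith)) (hP t ht)
    calc Real.exp ((η - 1) * t) * Q (X t) (X t + ε t • v)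
        ≤ Real.exp ((η - 1) * t) * -((η - 1) * G t + G' t) :=
          mul_le_mul_of_nonneg_left (by linarith) (hexp0 t).le
      _ = _ := by ring
  have hstart : Real.exp ((η - 1) * 0) * G 0 = f x - m + B / 2 * ‖z - p x‖ ^ 2 := by
    have e : z - p x = v + (x - p x) := by rw [hv]; abel
    rw [e, norm_add_sq_real]
    simp [hG, hX, ha, hε]
  rw [← hstart]
  refine lintegral_expMeasure_one_le (F := fun t => Real.exp ((η - 1) * t) * G t) hh hFd
    (fun t ht => mul_nonneg (hexp0 t).le (hG0 t ht)) (fun t ht => ?_) fun t ht => ?_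
  · have := mul_nonneg (hexp0 t).le (hQ0 (X t) (X t + ε t • v))
    linarith [key t ht]
  · calc ENNReal.ofReal (Real.exp (-t)) * h t
        ≤ ENNReal.ofReal (Real.exp (-t)) * (ENNReal.ofReal (Real.exp (η * t))
          * ENNReal.ofReal (Q (X t) (X t + ε t • v))) := by gcongr; exact hhQ t
      _ = ENNReal.ofReal (Real.exp ((η - 1) * t) * Q (X t) (X t + ε t • v)) := by
        rw [← mul_assoc, ← ENNReal.ofReal_mul (Real.exp_pos _).le, ← Real.exp_add,
          ← ENNReal.ofReal_mul (Real.exp_pos _).le]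
        congr 3
        ring_nf
      _ ≤ _ := ENNReal.ofReal_le_ofReal (key t ht)

end Flow

/-! ### Expected decrease at a jump -/

section Jump

variable {d : ℕ}

theorem isClosed_argminSet {f : EuclideanSpace ℝ (Fin d) → ℝ} (hf : Continuous f) :
    IsClosed (argminSet f) := by
  simp only [argminSet, Set.ofPred_forall]
  exact isClosed_iInter fun y => isClosed_le hf continuous_const

theorem orthProj_variational {S : Set (EuclideanSpace ℝ (Fin d))} (hS : S.Nonempty)
    (hc : IsClosed S) (hconv : Convex ℝ S) (x y : EuclideanSpace ℝ (Fin d)) :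
    ⟪x - orthProj S x, orthProj S y - orthProj S x⟫ ≤ 0 := by
  obtain ⟨hx, hmin⟩ := orthProj_spec hS hc x
  have : Nonempty S := hS.to_subtype
  refine (norm_eq_iInf_iff_real_inner_le_zero hconv hx).1 (le_antisymm
    (le_ciInf fun w => hmin w w.2) (ciInf_le ⟨0, ?_⟩ (⟨_, hx⟩ : S))) _ (orthProj_spec hS hc y).1
  rintro _ ⟨w, rfl⟩
  exact norm_nonneg _

/-- The Lyapunov function of the continuized Nesterov process. -/
noncomputable def lyapunov (f : EuclideanSpace ℝ (Fin d) → ℝ) (B : ℝ)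
    (x z : EuclideanSpace ℝ (Fin d)) : ℝ :=
  f x - minVal f + B / 2 * ‖z - orthProj (argminSet f) x‖ ^ 2

theorem minVal_le {f : EuclideanSpace ℝ (Fin d) → ℝ} (hne : (argminSet f).Nonempty)
    (x : EuclideanSpace ℝ (Fin d)) : minVal f ≤ f x := by
  obtain ⟨w, hw⟩ := hne
  rw [minVal_eq hw]
  exact hw x

theorem lyapunov_nonneg {f : EuclideanSpace ℝ (Fin d) → ℝ} (hne : (argminSet f).Nonempty) {B : ℝ}
    (hB : 0 ≤ B) (x z : EuclideanSpace ℝ (Fin d)) : 0 ≤ lyapunov f B x z := by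
  have := minVal_le hne x
  exact add_nonneg (by linarith) (by positivity)

/-- The Lyapunov function minus its drift along the flow, discounted at rate `η`. -/
noncomputable def driftBound (f : EuclideanSpace ℝ (Fin d) → ℝ) (B η η' : ℝ)
    (x z : EuclideanSpace ℝ (Fin d)) : ℝ :=
  (1 - η) * lyapunov f B x z - η * ⟪∇ f x, z - x⟫
    - B * η' * ⟪z - orthProj (argminSet f) x, x - z⟫

theorem lintegral_jump_le {f : EuclideanSpace ℝ (Fin d) → ℝ} (hf : Continuous f)
    (hne : (argminSet f).Nonempty) (hconv : Convex ℝ (argminSet f)) {L μ ρ : ℝ} (hL : 0 ≤ L)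
    (hsmooth : IsLSmooth L f) (hsqc : IsProjSQC μ f) {Ξ : Type*} [MeasurableSpace Ξ] {P : Measure Ξ}
    [IsProbabilityMeasure P] {g : EuclideanSpace ℝ (Fin d) → Ξ → EuclideanSpace ℝ (Fin d)}
    (hsgc : IsSGC ρ f g P) {B η η' γ γ' : ℝ} (hB : 0 ≤ B) (hη : 0 ≤ η) (hηη' : η ≤ η')
    (hη' : 0 < η') (hγ : 0 < γ) (hγγ' : γ ≤ γ') (hBγ : B * γ' = η) (hBη : B * η' = η * μ)
    (hgrad : -γ + L * γ ^ 2 * ρ / 2 + B / 2 * (γ' ^ 2 + γ ^ 2 / η') * ρ ≤ 0)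
    (x z : EuclideanSpace ℝ (Fin d)) :
    0 ≤ driftBound f B η η' x z ∧
    ∫⁻ ξ, ENNReal.ofReal (lyapunov f B (x - γ • g x ξ) (z - γ' • g x ξ)) ∂P
      ≤ ENNReal.ofReal (driftBound f B η η' x z) := by
  have hp := orthProj_variational hne (isClosed_argminSet hf) hconv
  set p := orthProj (argminSet f) with hpdef
  set n := ∇ f x with hn
  set A := γ' ^ 2 + γ ^ 2 / η' with hA
  have hA0 : 0 ≤ A := by positivity
  -- Pathwise bound from smoothness and the displacement of the anchor, with Young weight η'. It is
  -- affine in `g x ξ` and ‖g x ξ‖², so its mean needs only unbiasedness and growth.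
  set U : Ξ → ℝ := fun ξ => (lyapunov f B x z + B / 2 * (η' * ‖z - x‖ ^ 2))
    - ⟪γ • n + (B * γ') • (z - p x), g x ξ⟫ + (L * γ ^ 2 / 2 + B / 2 * A) * ‖g x ξ‖ ^ 2 with hU
  have hle (ξ : Ξ) : lyapunov f B (x - γ • g x ξ) (z - γ' • g x ξ) ≤ U ξ := by
    have h1 := hsmooth (x - γ • g x ξ) x
    have h2 := norm_step_sub_sq_le hp hγ hγγ' hη' x z (g x ξ)
    have h3 : x - γ • g x ξ - x = -(γ • g x ξ) := by abel
    rw [h3, norm_neg, inner_neg_right, norm_smul, Real.norm_eq_abs, mul_pow, sq_abs,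
      real_inner_smul_right] at h1
    have h4 := mul_le_mul_of_nonneg_left h2 (show 0 ≤ B / 2 by positivity)
    simp only [lyapunov, hU, ← hpdef, inner_add_left, real_inner_smul_left]
    linarith
  have hUi1 : Integrable (fun ξ => ⟪γ • n + (B * γ') • (z - p x), g x ξ⟫) P :=
    (hsgc.integrable x).const_inner _
  have hUi2 : Integrable (fun ξ => (L * γ ^ 2 / 2 + B / 2 * A) * ‖g x ξ‖ ^ 2) P :=
    (hsgc.integrable_sq x).const_mul _
  have hUi3 : Integrable (fun ξ => (lyapunov f B x z + B / 2 * (η' * ‖z - x‖ ^ 2))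
    - ⟪γ • n + (B * γ') • (z - p x), g x ξ⟫) P := (integrable_const _).sub hUi1
  have hUi : Integrable U P := hUi3.add hUi2
  have hU0 (ξ : Ξ) : 0 ≤ U ξ := (lyapunov_nonneg hne hB _ _).trans (hle ξ)
  have hUint : ∫ ξ, U ξ ∂P ≤ driftBound f B η η' x z := by
    have h1 : ∫ ξ, U ξ ∂P = (lyapunov f B x z + B / 2 * (η' * ‖z - x‖ ^ 2))
        - ⟪γ • n + (B * γ') • (z - p x), n⟫
        + (L * γ ^ 2 / 2 + B / 2 * A) * ∫ ξ, ‖g x ξ‖ ^ 2 ∂P := by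
      rw [hU, integral_add hUi3 hUi2, integral_sub (integrable_const _) hUi1,
        integral_inner (hsgc.integrable x), hsgc.unbiased, integral_const_mul, integral_const,
        probReal_univ, one_smul]
    have h2 : (L * γ ^ 2 / 2 + B / 2 * A) * ∫ ξ, ‖g x ξ‖ ^ 2 ∂P
        ≤ (L * γ ^ 2 / 2 + B / 2 * A) * (ρ * ‖n‖ ^ 2) :=
      mul_le_mul_of_nonneg_left (hsgc.growth x) (by positivity)
    have h3 := hsqc x
    rw [← hpdef, ← hn, ← neg_sub x (p x), inner_neg_right] at h3
    have h4 := mul_le_mul_of_nonneg_left h3 hη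
    have h5 : 0 ≤ B * (η' - η) * ‖z - p x‖ ^ 2 := by
      have : 0 ≤ η' - η := by linarith
      positivity
    have h6 := mul_nonpos_of_nonpos_of_nonneg hgrad (sq_nonneg ‖n‖)
    have h7 : ⟪γ • n + (B * γ') • (z - p x), n⟫
        = γ * ‖n‖ ^ 2 + η * (⟪n, z - x⟫ + ⟪n, x - p x⟫) := by
      rw [inner_add_left, real_inner_smul_left, real_inner_smul_left, real_inner_self_eq_norm_sq,
        hBγ, real_inner_comm n, ← inner_add_right, sub_add_sub_cancel]
    have h8 : ‖x - p x‖ ^ 2 = ‖z - p x‖ ^ 2 + 2 * ⟪z - p x, x - z⟫ + ‖z - x‖ ^ 2 := by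
      rw [norm_sub_rev z x, ← norm_add_sq_real]
      congr 2
      abel
    -- The quasar-convexity gain, split at `z`: its ‖z - x‖² part cancels the Young error, and its
    -- cross term is the one in `driftBound`.
    have h9 : η * μ * ‖x - p x‖ ^ 2
        = B * η' * (‖z - p x‖ ^ 2 + 2 * ⟪z - p x, x - z⟫ + ‖z - x‖ ^ 2) := by
      rw [← hBη, h8]
    rw [h1, h7]
    simp only [driftBound, lyapunov, ← hpdef, ← hn]
    nlinarith
  refine ⟨(integral_nonneg hU0).trans hUint, ?_⟩
  calc _ ≤ ∫⁻ ξ, ENNReal.ofReal (U ξ) ∂P := lintegral_mono fun ξ => ENNReal.ofReal_le_ofReal (hle ξ)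
    _ = ENNReal.ofReal (∫ ξ, U ξ ∂P) :=
      (ofReal_integral_eq_lintegral_ofReal hUi (Filter.Eventually.of_forall hU0)).symm
    _ ≤ _ := ENNReal.ofReal_le_ofReal hUint

end Jump

/-! ### Independence of the next innovation from the past -/

section Independence

variable {Ω : Type*} {mΩ : MeasurableSpace Ω} {Pr : Measure Ω}

theorem isPiSystem_inter (m₁ m₂ : MeasurableSpace Ω) :
    IsPiSystem {u | ∃ s t, MeasurableSet[m₁] s ∧ MeasurableSet[m₂] t ∧ u = s ∩ t} := by
  rintro _ ⟨s, t, hs, ht, rfl⟩ _ ⟨s', t', hs', ht', rfl⟩ -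
  exact ⟨s ∩ s', t ∩ t', hs.inter hs', ht.inter ht', Set.inter_inter_inter_comm ..⟩

theorem sup_eq_generateFrom_inter (m₁ m₂ : MeasurableSpace Ω) :
    m₁ ⊔ m₂ = MeasurableSpace.generateFrom
      {u | ∃ s t, MeasurableSet[m₁] s ∧ MeasurableSet[m₂] t ∧ u = s ∩ t} := by
  refine le_antisymm (sup_le (fun s hs => ?_) fun t ht => ?_) (MeasurableSpace.generateFrom_le ?_)
  · exact MeasurableSpace.measurableSet_generateFrom
      ⟨s, Set.univ, hs, MeasurableSet.univ, (Set.inter_univ s).symm⟩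
  · exact MeasurableSpace.measurableSet_generateFrom
      ⟨Set.univ, t, MeasurableSet.univ, ht, (Set.univ_inter t).symm⟩
  · rintro _ ⟨s, t, hs, ht, rfl⟩
    exact MeasurableSet.inter ((le_sup_left : m₁ ≤ m₁ ⊔ m₂) s hs)
      ((le_sup_right : m₂ ≤ m₁ ⊔ m₂) t ht)

/-- On the generating π-systems of intersections, all four events factor. This regroups "times
versus samples" into "past versus next". -/
theorem Indep.sup_sup_of_indep [IsProbabilityMeasure Pr] {m₁ m₂ m₃ m₄ : MeasurableSpace Ω}
    (h₁ : m₁ ≤ mΩ) (h₂ : m₂ ≤ mΩ) (h₃ : m₃ ≤ mΩ) (h₄ : m₄ ≤ mΩ) (h₁₂ : Indep m₁ m₂ Pr)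
    (h₃₄ : Indep m₃ m₄ Pr) (h : Indep (m₁ ⊔ m₂) (m₃ ⊔ m₄) Pr) :
    Indep (m₁ ⊔ m₃) (m₂ ⊔ m₄) Pr := by
  refine IndepSets.indep (sup_le h₁ h₃) (sup_le h₂ h₄) (isPiSystem_inter m₁ m₃)
    (isPiSystem_inter m₂ m₄) (sup_eq_generateFrom_inter m₁ m₃) (sup_eq_generateFrom_inter m₂ m₄) ?_
  rw [IndepSets_iff]
  rintro _ _ ⟨a, b, ha, hb, rfl⟩ ⟨c, d, hc, hd, rfl⟩
  rw [Indep_iff] at h₁₂ h₃₄ h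
  have ha' := (le_sup_left : m₁ ≤ m₁ ⊔ m₂) a ha
  have hc' := (le_sup_right : m₂ ≤ m₁ ⊔ m₂) c hc
  have hb' := (le_sup_left : m₃ ≤ m₃ ⊔ m₄) b hb
  have hd' := (le_sup_right : m₄ ≤ m₃ ⊔ m₄) d hd
  rw [Set.inter_inter_inter_comm, h _ _ (MeasurableSet.inter ha' hc') (MeasurableSet.inter hb' hd'),
    h₁₂ a c ha hc, h₃₄ b d hb hd, h a b ha' hb', h c d hc' hd']
  ring

/-- The σ-algebra generated by the first `k` terms of each of two sequences. -/
abbrev pastSigma {α β : Type*} [MeasurableSpace α] [MeasurableSpace β] (τ : ℕ → Ω → α)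
    (ζ : ℕ → Ω → β) (k : ℕ) : MeasurableSpace Ω :=
  (⨆ j ∈ Set.Iio k, MeasurableSpace.comap (τ j) inferInstance) ⊔
    ⨆ j ∈ Set.Iio k, MeasurableSpace.comap (ζ j) inferInstance

variable {α β : Type*} [MeasurableSpace α] [MeasurableSpace β] {τ : ℕ → Ω → α} {ζ : ℕ → Ω → β}

theorem pastSigma_mono {j k : ℕ} (h : j ≤ k) : pastSigma τ ζ j ≤ pastSigma τ ζ k :=
  sup_le_sup (biSup_mono fun _ hi => lt_of_lt_of_le hi h)
    (biSup_mono fun _ hi => lt_of_lt_of_le hi h)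

theorem measurable_pastSigma_left {j k : ℕ} (h : j < k) : Measurable[pastSigma τ ζ k] (τ j) :=
  measurable_iff_comap_le.2 (le_sup_of_le_left (le_biSup
    (fun j => MeasurableSpace.comap (τ j) inferInstance) (Set.mem_Iio.2 h)))

theorem measurable_pastSigma_right {j k : ℕ} (h : j < k) : Measurable[pastSigma τ ζ k] (ζ j) :=
  measurable_iff_comap_le.2 (le_sup_of_le_right (le_biSup
    (fun j => MeasurableSpace.comap (ζ j) inferInstance) (Set.mem_Iio.2 h)))

theorem pastSigma_le (hτ : ∀ k, Measurable (τ k)) (hζ : ∀ k, Measurable (ζ k)) (k : ℕ) :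
    pastSigma τ ζ k ≤ mΩ :=
  sup_le (iSup₂_le fun j _ => (hτ j).comap_le) (iSup₂_le fun j _ => (hζ j).comap_le)

theorem indep_iSup_Iio_comap (hτ : ∀ k, Measurable (τ k)) (hτi : iIndepFun τ Pr) (k : ℕ) :
    Indep (⨆ j ∈ Set.Iio k, MeasurableSpace.comap (τ j) inferInstance)
      (MeasurableSpace.comap (τ k) inferInstance) Pr := by
  have := indep_iSup_of_disjoint (S := Set.Iio k) (T := {k}) (fun j => (hτ j).comap_le) hτi
    (by simp)
  simpa using this

theorem comap_apply_le_comap_pi (τ : ℕ → Ω → α) (j : ℕ) :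
    MeasurableSpace.comap (τ j) inferInstance
      ≤ MeasurableSpace.comap (fun ω k => τ k ω) MeasurableSpace.pi := by
  have : τ j = (fun v : ℕ → α => v j) ∘ fun ω k => τ k ω := rfl
  rw [this, ← MeasurableSpace.comap_comp]
  exact MeasurableSpace.comap_mono (measurable_pi_apply j).comap_le

theorem indep_pastSigma [IsProbabilityMeasure Pr] (hτ : ∀ k, Measurable (τ k))
    (hζ : ∀ k, Measurable (ζ k)) (hτi : iIndepFun τ Pr) (hζi : iIndepFun ζ Pr)
    (h : IndepFun (fun ω k => τ k ω) (fun ω k => ζ k ω) Pr) (k : ℕ) :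
    Indep (pastSigma τ ζ k) (MeasurableSpace.comap (τ k) inferInstance ⊔
      MeasurableSpace.comap (ζ k) inferInstance) Pr := by
  refine Indep.sup_sup_of_indep (iSup₂_le fun j _ => (hτ j).comap_le) (hτ k).comap_le
    (iSup₂_le fun j _ => (hζ j).comap_le) (hζ k).comap_le (indep_iSup_Iio_comap hτ hτi k)
    (indep_iSup_Iio_comap hζ hζi k) ?_
  exact indep_of_indep_of_le_left (indep_of_indep_of_le_right h
    (sup_le (iSup₂_le fun j _ => comap_apply_le_comap_pi ζ j) (comap_apply_le_comap_pi ζ k)))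
    (sup_le (iSup₂_le fun j _ => comap_apply_le_comap_pi τ j) (comap_apply_le_comap_pi τ k))

/-- Integrating out the next pair of innovations, given a state that depends on the past. -/
theorem lintegral_past_innovation [IsProbabilityMeasure Pr] (hτ : ∀ k, Measurable (τ k))
    (hζ : ∀ k, Measurable (ζ k)) (hτi : iIndepFun τ Pr) (hζi : iIndepFun ζ Pr)
    (h : IndepFun (fun ω k => τ k ω) (fun ω k => ζ k ω) Pr) (k : ℕ) {S : Type*}
    [MeasurableSpace S] {X : Ω → S} (hX : Measurable[pastSigma τ ζ k] X)
    {H : S → α → β → ENNReal} (hH : Measurable fun w : S × α × β => H w.1 w.2.1 w.2.2) :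
    ∫⁻ ω, H (X ω) (τ k ω) (ζ k ω) ∂Pr
      = ∫⁻ ω, ∫⁻ a, ∫⁻ b, H (X ω) a b ∂(Pr.map (ζ k)) ∂(Pr.map (τ k)) ∂Pr := by
  have hXm : Measurable X := hX.mono (pastSigma_le hτ hζ k) le_rfl
  have hpair : IndepFun (τ k) (ζ k) Pr :=
    h.comp (measurable_pi_apply k) (measurable_pi_apply k)
  have hpairm : Measurable fun ω => (τ k ω, ζ k ω) := (hτ k).prodMk (hζ k)
  have hind : IndepFun X (fun ω => (τ k ω, ζ k ω)) Pr := by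
    refine indep_of_indep_of_le_left (indep_of_indep_of_le_right
      (indep_pastSigma hτ hζ hτi hζi h k) ?_) hX.comap_le
    exact (MeasurableSpace.comap_prodMk (τ k) (ζ k)).le
  have : IsProbabilityMeasure (Pr.map (τ k)) := Measure.isProbabilityMeasure_map (hτ k).aemeasurable
  have : IsProbabilityMeasure (Pr.map (ζ k)) := Measure.isProbabilityMeasure_map (hζ k).aemeasurable
  have : IsProbabilityMeasure (Pr.map X) := Measure.isProbabilityMeasure_map hXm.aemeasurable
  have hlaw := (indepFun_iff_map_prod_eq_prod_map_map hXm.aemeasurable hpairm.aemeasurable).1 hind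
  rw [(indepFun_iff_map_prod_eq_prod_map_map (hτ k).aemeasurable (hζ k).aemeasurable).1 hpair]
    at hlaw
  calc ∫⁻ ω, H (X ω) (τ k ω) (ζ k ω) ∂Pr
      = ∫⁻ w, H w.1 w.2.1 w.2.2 ∂(Pr.map fun ω => (X ω, τ k ω, ζ k ω)) :=
        (lintegral_map hH (hXm.prodMk hpairm)).symm
    _ = ∫⁻ s, ∫⁻ w, H s w.1 w.2 ∂((Pr.map (τ k)).prod (Pr.map (ζ k))) ∂(Pr.map X) := by
        rw [hlaw, lintegral_prod _ hH.aemeasurable]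
    _ = ∫⁻ ω, ∫⁻ w, H (X ω) w.1 w.2 ∂((Pr.map (τ k)).prod (Pr.map (ζ k))) ∂Pr :=
        lintegral_map hH.lintegral_prod_right' hXm
    _ = _ := by
        refine lintegral_congr fun ω => ?_
        exact lintegral_prod _ (hH.comp measurable_prodMk_left).aemeasurable

end Independence

/-! ### The iterates as samples of the flow -/

section Iterates

theorem IsCNA.y_eq_flowFst {d : ℕ} {Ω Ξ : Type*}
    {g : EuclideanSpace ℝ (Fin d) → Ξ → EuclideanSpace ℝ (Fin d)} {η η' γ γ' : ℝ}
    {T : ℕ → Ω → ℝ} {ξ : ℕ → Ω → Ξ} {x₀ : EuclideanSpace ℝ (Fin d)}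
    {x y z : ℕ → Ω → EuclideanSpace ℝ (Fin d)} (h : IsCNA g η η' γ γ' T ξ x₀ x y z) (k : ℕ)
    (ω : Ω) : y k ω = flowFst η η' (x k ω) (z k ω) (T (k + 1) ω - T k ω) := by
  rw [h.y_eq, add_comm]
  rfl

theorem IsCNA.z_succ_eq_flowSnd {d : ℕ} {Ω Ξ : Type*}
    {g : EuclideanSpace ℝ (Fin d) → Ξ → EuclideanSpace ℝ (Fin d)} {η η' γ γ' : ℝ}
    {T : ℕ → Ω → ℝ} {ξ : ℕ → Ω → Ξ} {x₀ : EuclideanSpace ℝ (Fin d)}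
    {x y z : ℕ → Ω → EuclideanSpace ℝ (Fin d)} (h : IsCNA g η η' γ γ' T ξ x₀ x y z)
    (hη : 0 ≤ η) (hη' : 0 < η') (k : ℕ) (ω : Ω) :
    z (k + 1) ω = flowSnd η η' (x k ω) (z k ω) (T (k + 1) ω - T k ω)
      - γ' • g (y k ω) (ξ (k + 1) ω) := by
  rw [h.z_succ, flowSnd, ← h.y_eq_flowFst, sub_left_inj]
  conv_lhs => rw [h.y_eq]
  conv_rhs => rw [h.y_eq]
  set E := Real.exp (-(η + η') * (T (k + 1) ω - T k ω)) with hE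
  have hE0 : 0 < E := Real.exp_pos _
  -- This is the ratio of y - z to z - x; the denominator in the update of z cancels it.
  have h1 : η / (η + η') * (1 - E) - 1 = -((η' + η * E) / (η + η')) := by
    field_simp
    ring
  have h3 : η' * ((1 - E) / (η' + η * E)) * (η / (η + η') * (1 - E) - 1)
      = η / (η + η') * (1 - E) + E - 1 := by
    rw [h1]
    have : η' + η * E ≠ 0 := by positivity
    field_simp
    ring
  have h4 : (η / (η + η') * (1 - E)) • (z k ω - x k ω) + x k ω - z k ω
      = (η / (η + η') * (1 - E) - 1) • (z k ω - x k ω) := by module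
  rw [h4, smul_smul, h3]
  module

variable {d : ℕ} {Ω Ξ : Type*} {mΩ : MeasurableSpace Ω} [MeasurableSpace Ξ]
  {g : EuclideanSpace ℝ (Fin d) → Ξ → EuclideanSpace ℝ (Fin d)} {η η' γ γ' : ℝ}
  {T : ℕ → Ω → ℝ} {ξ : ℕ → Ω → Ξ} {x₀ : EuclideanSpace ℝ (Fin d)}
  {x y z : ℕ → Ω → EuclideanSpace ℝ (Fin d)}

theorem IsCNA.measurable_pastSigma (h : IsCNA g η η' γ γ' T ξ x₀ x y z)
    (hg : Measurable (Function.uncurry g)) (hT : ∀ ω, T 0 ω = 0) (k : ℕ) :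
    Measurable[pastSigma (fun k ω => T (k + 1) ω - T k ω) (fun k => ξ (k + 1)) k]
      fun ω => (T k ω, x k ω, z k ω) := by
  induction k with
  | zero =>
    simp only [hT, h.x_zero, h.z_zero]
    exact measurable_const
  | succ k ih =>
    set τ : ℕ → Ω → ℝ := fun k ω => T (k + 1) ω - T k ω with hτ
    have hS := ih.mono (pastSigma_mono (τ := τ) (ζ := fun k => ξ (k + 1)) k.le_succ) le_rfl
    have hτm := measurable_pastSigma_left (τ := τ) (ζ := fun k => ξ (k + 1)) k.lt_succ_self
    have hξm := measurable_pastSigma_right (τ := τ) (ζ := fun k => ξ (k + 1)) k.lt_succ_self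
    -- From here measurability refers to innovations 0, …, k, which determine the state of index k +
    -- 1.
    let : MeasurableSpace Ω := pastSigma τ (fun k => ξ (k + 1)) (k + 1)
    have hTm : Measurable (T k) := measurable_fst.comp hS
    have hxm : Measurable (x k) := measurable_fst.comp (measurable_snd.comp hS)
    have hzm : Measurable (z k) := measurable_snd.comp (measurable_snd.comp hS)
    have hτm' : Measurable fun ω => T (k + 1) ω - T k ω := hτm
    have hym : Measurable (y k) := by
      rw [show y k = _ from funext (h.y_eq k)]
      fun_prop
    have hgm : Measurable fun ω => g (y k ω) (ξ (k + 1) ω) := hg.comp (hym.prodMk hξm)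
    refine Measurable.prodMk ?_ (Measurable.prodMk ?_ ?_)
    · rw [show T (k + 1) = fun ω => T k ω + (T (k + 1) ω - T k ω) from
        funext fun ω => (add_sub_cancel _ _).symm]
      exact hTm.add hτm'
    · rw [show x (k + 1) = _ from funext (h.x_succ k)]
      fun_prop
    · rw [show z (k + 1) = _ from funext (h.z_succ k)]
      fun_prop

end Iterates

/-! ### Induction on the jumps and conclusion -/

theorem measurable_lyapunov {d : ℕ} {f : EuclideanSpace ℝ (Fin d) → ℝ} (hf : Continuous f)
    (hne : (argminSet f).Nonempty) (hconv : Convex ℝ (argminSet f)) (B : ℝ) :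
    Measurable fun w : EuclideanSpace ℝ (Fin d) × EuclideanSpace ℝ (Fin d) =>
      lyapunov f B w.1 w.2 := by
  have hp := continuous_of_variational
    (orthProj_variational hne (isClosed_argminSet hf) hconv)
  refine Continuous.measurable ?_
  unfold lyapunov
  fun_prop

theorem lintegral_lyapunov_le {d : ℕ} {f : EuclideanSpace ℝ (Fin d) → ℝ} (hf : Differentiable ℝ f)
    (hne : (argminSet f).Nonempty) (hconv : Convex ℝ (argminSet f)) {Ξ : Type*}
    [MeasurableSpace Ξ] {P : Measure Ξ} [IsProbabilityMeasure P]
    {g : EuclideanSpace ℝ (Fin d) → Ξ → EuclideanSpace ℝ (Fin d)}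
    (hg : Measurable (Function.uncurry g)) {B η η' γ γ' : ℝ} (hB : 0 ≤ B) (hη : 0 ≤ η)
    (hη' : 0 < η')
    (hjump : ∀ x z, 0 ≤ driftBound f B η η' x z ∧
      ∫⁻ ξ, ENNReal.ofReal (lyapunov f B (x - γ • g x ξ) (z - γ' • g x ξ)) ∂P
        ≤ ENNReal.ofReal (driftBound f B η η' x z))
    {Ω : Type*} [MeasurableSpace Ω] {Pr : Measure Ω} [IsProbabilityMeasure Pr]
    {T : ℕ → Ω → ℝ} (hT : IsExpArrivals Pr T) {ξ : ℕ → Ω → Ξ} (hξ : IsIIDSamples Pr P ξ)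
    (hTξ : IndepFun (fun ω k => T (k + 1) ω - T k ω) (fun ω k => ξ (k + 1) ω) Pr)
    {x₀ : EuclideanSpace ℝ (Fin d)} {x y z : ℕ → Ω → EuclideanSpace ℝ (Fin d)}
    (hCNA : IsCNA g η η' γ γ' T ξ x₀ x y z) (k : ℕ) :
    ∫⁻ ω, ENNReal.ofReal (Real.exp (η * T k ω)) * ENNReal.ofReal (lyapunov f B (x k ω) (z k ω)) ∂Pr
      ≤ ENNReal.ofReal (lyapunov f B x₀ x₀) := by
  have hm := measurable_lyapunov hf.continuous hne hconv B
  induction k with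
  | zero => simp [hT.zero, hCNA.x_zero, hCNA.z_zero]
  | succ k ih =>
    have hflow : Measurable fun w : (ℝ × EuclideanSpace ℝ (Fin d) × EuclideanSpace ℝ (Fin d)) ×
        ℝ × Ξ => flowFst η η' w.1.2.1 w.1.2.2 w.2.1 := by
      unfold flowFst
      fun_prop
    have hflow' : Measurable fun w : (ℝ × EuclideanSpace ℝ (Fin d) × EuclideanSpace ℝ (Fin d)) ×
        ℝ × Ξ => flowSnd η η' w.1.2.1 w.1.2.2 w.2.1 := by
      unfold flowSnd
      fun_prop
    have hgm : Measurable fun w : (ℝ × EuclideanSpace ℝ (Fin d) × EuclideanSpace ℝ (Fin d)) ×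
        ℝ × Ξ => g (flowFst η η' w.1.2.1 w.1.2.2 w.2.1) w.2.2 :=
      hg.comp (hflow.prodMk (by fun_prop))
    set H : ℝ × EuclideanSpace ℝ (Fin d) × EuclideanSpace ℝ (Fin d) → ℝ → Ξ → ENNReal :=
      fun s t a => ENNReal.ofReal (Real.exp (η * s.1)) * (ENNReal.ofReal (Real.exp (η * t)) *
        ENNReal.ofReal (lyapunov f B
          (flowFst η η' s.2.1 s.2.2 t - γ • g (flowFst η η' s.2.1 s.2.2 t) a)
          (flowSnd η η' s.2.1 s.2.2 t - γ' • g (flowFst η η' s.2.1 s.2.2 t) a))) with hH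
    have hlyap : Measurable fun w : (ℝ × EuclideanSpace ℝ (Fin d) × EuclideanSpace ℝ (Fin d)) ×
        ℝ × Ξ => ENNReal.ofReal (lyapunov f B
          (flowFst η η' w.1.2.1 w.1.2.2 w.2.1 - γ • g (flowFst η η' w.1.2.1 w.1.2.2 w.2.1) w.2.2)
          (flowSnd η η' w.1.2.1 w.1.2.2 w.2.1 - γ' • g (flowFst η η' w.1.2.1 w.1.2.2 w.2.1) w.2.2)) :=
      (hm.comp ((hflow.sub (hgm.const_smul γ)).prodMk
        (hflow'.sub (hgm.const_smul γ')))).ennreal_ofReal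
    have hHm : Measurable fun w : (ℝ × EuclideanSpace ℝ (Fin d) × EuclideanSpace ℝ (Fin d)) ×
        ℝ × Ξ => H w.1 w.2.1 w.2.2 := by
      simp only [hH]
      fun_prop
    have hP := isProbabilityMeasure_expMeasure one_pos
    calc _ = ∫⁻ ω, H (T k ω, x k ω, z k ω) (T (k + 1) ω - T k ω) (ξ (k + 1) ω) ∂Pr := by
          refine lintegral_congr fun ω => ?_
          simp only [hH]
          rw [hCNA.x_succ, hCNA.z_succ_eq_flowSnd hη hη', ← mul_assoc,
            ← ENNReal.ofReal_mul (Real.exp_pos (η * T k ω)).le, ← Real.exp_add, ← mul_add,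
            add_sub_cancel, hCNA.y_eq_flowFst]
      _ = ∫⁻ ω, ∫⁻ t, ∫⁻ a, H (T k ω, x k ω, z k ω) t a ∂P ∂(expMeasure 1) ∂Pr := by
          have := lintegral_past_innovation (τ := fun k ω => T (k + 1) ω - T k ω)
            (ζ := fun k => ξ (k + 1)) (fun k => (hT.measurable (k + 1)).sub (hT.measurable k))
            hξ.measurable hT.indep hξ.indep hTξ k (hCNA.measurable_pastSigma hg hT.zero k) hHm
          rwa [hT.law, hξ.law] at this
      _ ≤ ∫⁻ ω, ENNReal.ofReal (Real.exp (η * T k ω))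
            * ENNReal.ofReal (lyapunov f B (x k ω) (z k ω)) ∂Pr := by
          refine lintegral_mono fun ω => ?_
          have hsec (t : ℝ) : Measurable fun a => ENNReal.ofReal (lyapunov f B
              (flowFst η η' (x k ω) (z k ω) t - γ • g (flowFst η η' (x k ω) (z k ω) t) a)
              (flowSnd η η' (x k ω) (z k ω) t - γ' • g (flowFst η η' (x k ω) (z k ω) t) a)) :=
            hlyap.comp (g := fun w => _) (f := fun a => ((0, x k ω, z k ω), t, a)) (by fun_prop)
          have hsec' : Measurable fun t => ENNReal.ofReal (Real.exp (η * t)) *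
              ∫⁻ a, ENNReal.ofReal (lyapunov f B
              (flowFst η η' (x k ω) (z k ω) t - γ • g (flowFst η η' (x k ω) (z k ω) t) a)
              (flowSnd η η' (x k ω) (z k ω) t - γ' • g (flowFst η η' (x k ω) (z k ω) t) a)) ∂P := by
            refine Measurable.mul (by fun_prop) (Measurable.lintegral_prod_right' (f := fun w : ℝ × Ξ =>
              ENNReal.ofReal (lyapunov f B (flowFst η η' (x k ω) (z k ω) w.1
                - γ • g (flowFst η η' (x k ω) (z k ω) w.1) w.2)
              (flowSnd η η' (x k ω) (z k ω) w.1
                - γ' • g (flowFst η η' (x k ω) (z k ω) w.1) w.2))) ?_)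
            exact hlyap.comp (g := fun w => _) (f := fun w : ℝ × Ξ => ((0, x k ω, z k ω), w.1, w.2))
              (by fun_prop)
          simp only [hH]
          simp_rw [lintegral_const_mul _ ((hsec _).const_mul _), lintegral_const_mul _ (hsec _)]
          rw [lintegral_const_mul _ hsec']
          gcongr
          exact lintegral_flow_le
            (orthProj_variational hne (isClosed_argminSet hf.continuous) hconv)
            (fun x => (hf x).hasGradientAt) (minVal_le hne) hB hη hη' (fun _ _ => rfl)
            (fun x z => (hjump x z).1) _ _ hsec' fun t => by gcongr; exact (hjump _ _).2
      _ ≤ _ := ih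

theorem theorem5 {d : ℕ} (f : EuclideanSpace ℝ (Fin d) → ℝ) (hf : Differentiable ℝ f)
    (hne : (argminSet f).Nonempty)
    {L μ ρ : ℝ} (hL : 0 < L) (hμ : 0 < μ) (hρ : 1 ≤ ρ)
    (hκ : μ / L ≤ growthConst ρ ^ (-4 : ℤ))
    (hsmooth : IsLSmooth L f) (hsqc : IsProjSQC μ f)
    {Ξ : Type*} [MeasurableSpace Ξ] (P : Measure Ξ) [IsProbabilityMeasure P]
    (g : EuclideanSpace ℝ (Fin d) → Ξ → EuclideanSpace ℝ (Fin d)) (hsgc : IsSGC ρ f g P)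
    (hconv : Convex ℝ (argminSet f)) (hbdry : HasC2Boundary (argminSet f))
    {Ω : Type*} [MeasurableSpace Ω] (Pr : Measure Ω) [IsProbabilityMeasure Pr]
    (T : ℕ → Ω → ℝ) (hT : IsExpArrivals Pr T)
    (ξ : ℕ → Ω → Ξ) (hξ : IsIIDSamples Pr P ξ)
    (hTξ : IndepFun (fun ω k => T (k + 1) ω - T k ω) (fun ω k => ξ (k + 1) ω) Pr)
    {η η' γ γ' : ℝ} (hγ : γ = 1 / (ρ * L)) (hγ' : γ' = 1 / (ρ * √(μ * L)))
    (hη : η = (1 - growthConst ρ * (μ / L) ^ (1 / 4 : ℝ)) / ρ * √(μ / L))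
    (hη' : η' = 1 / ρ * √(μ / L))
    (x₀ : EuclideanSpace ℝ (Fin d)) (x y z : ℕ → Ω → EuclideanSpace ℝ (Fin d))
    (hCNA : IsCNA g η η' γ γ' T ξ x₀ x y z) (k : ℕ) :
    Integrable (fun ω => Real.exp (η * T k ω) * (f (x k ω) - minVal f)) Pr ∧
    ∫ ω, Real.exp (η * T k ω) * (f (x k ω) - minVal f) ∂Pr
      ≤ f x₀ - minVal f
        + μ * (1 - growthConst ρ * (μ / L) ^ (1 / 4 : ℝ))
          * ‖x₀ - orthProj (argminSet f) x₀‖ ^ 2 := by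
  obtain ⟨hB0, hη0, hηη', hη'0, hγ0, hγγ', hBγ, hBη, hgrad⟩ :=
    parameter_relations hL hμ hρ hκ hγ hγ' hη hη' rfl
  set B := μ * (1 - growthConst ρ * (μ / L) ^ (1 / 4 : ℝ)) with hB
  have hjump := lintegral_jump_le hf.continuous hne hconv hL.le hsmooth hsqc hsgc hB0 hη0 hηη' hη'0
    hγ0 hγγ' hBγ hBη hgrad
  have hbound := lintegral_lyapunov_le hf hne hconv hsgc.measurable hB0 hη0 hη'0 hjump hT hξ hTξ
    hCNA k
  have hnonneg (ω : Ω) : 0 ≤ Real.exp (η * T k ω) * (f (x k ω) - minVal f) :=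
    mul_nonneg (Real.exp_pos _).le (sub_nonneg.2 (minVal_le hne _))
  have hS := (hCNA.measurable_pastSigma hsgc.measurable hT.zero k).mono (pastSigma_le
    (fun k => (hT.measurable (k + 1)).sub (hT.measurable k)) hξ.measurable k) le_rfl
  have hxm : Measurable (x k) := measurable_fst.comp (measurable_snd.comp hS)
  have hmeas : Measurable fun ω => Real.exp (η * T k ω) * (f (x k ω) - minVal f) :=
    ((hT.measurable k).const_mul η).exp.mul
      ((hf.continuous.measurable.comp hxm).sub measurable_const)
  have hle : ∫⁻ ω, ENNReal.ofReal (Real.exp (η * T k ω) * (f (x k ω) - minVal f)) ∂Pr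
      ≤ ENNReal.ofReal (lyapunov f B x₀ x₀) := by
    refine le_trans (lintegral_mono fun ω => ?_) hbound
    rw [← ENNReal.ofReal_mul (Real.exp_pos _).le]
    refine ENNReal.ofReal_le_ofReal (mul_le_mul_of_nonneg_left ?_ (Real.exp_pos _).le)
    exact le_add_of_nonneg_right (by positivity)
  refine ⟨⟨hmeas.aestronglyMeasurable, ?_⟩, ?_⟩
  · rw [hasFiniteIntegral_iff_ofReal (Filter.Eventually.of_forall hnonneg)]
    exact hle.trans_lt ENNReal.ofReal_lt_top
  · rw [integral_eq_lintegral_of_nonneg_ae (Filter.Eventually.of_forall hnonneg)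
      hmeas.aestronglyMeasurable]
    refine (ENNReal.toReal_le_of_le_ofReal (lyapunov_nonneg hne hB0 _ _) hle).trans ?_
    unfold lyapunov
    -- The potential at (x₀, x₀) carries only B/2; the stated bound allows B.
    nlinarith [sq_nonneg ‖x₀ - orthProj (argminSet f) x₀‖,
      mul_nonneg hB0 (sq_nonneg ‖x₀ - orthProj (argminSet f) x₀‖)]
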